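/- Let $(V,\otimes,k)$ be a commutative quantale with internal hom $[-,-]$, and let $L$ be the list monad, extended to $V$-relations by $Lr((x_1,\dots,x_n),(y_1,\dots,y_n))=r(x_1,y_1)\otimes\cdots\otimes r(x_n,y_n)$, and $\bot$ on lists of different lengths. An $(L,V)$-category $(X,a)$ is a set $X$ with a map $a\colon LX\times X\to V$ such that $k\le a((x),x)$ for all $x$ and $La((\underline{x}_1,\dots,\underline{x}_n),\underline{y})\otimes a(\underline{y},z)\le a((\underline{x}_1;\dots;\underline{x}_n),z)$ for all lists of lists $(\underline{x}_1,\dots,\underline{x}_n)$, lists $\underline y$ and elements $z$, where $(\underline{x}_1;\dots;\underline{x}_n)$ is the concatenation. An $(L,V)$-functor $f\colon (X,a)\to(Y,b)$ is a map with $a(\underline{x},y)\le b(Lf(\underline{x}),f(y))$ for all $\underline x\in LX$, $y\in X$; it is fully faithful if equality always holds. A $V$-quantale $(Q,\ast,u)$ is a separated cocomplete $V$-category with a monoid structure whose multiplication is a $V$-functor $Q\boxtimes Q\to Q$ that is cocontinuous in each variable. It is regarded as an $(L,V)$-category by $Q((q_1,\dots,q_n),q)=Q(q_1\ast\cdots\ast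 q_n,q)$, the empty product being $u$. A fully faithful $(L,V)$-functor $i\colon (X,a)\to Q$ into a $V$-quantale is called dense if every $q\in Q$ satisfies $$q=\lim(i^{*}\cdot q_{*},\,i)\qquad\text{and}\qquad q=L\text{-}\mathrm{colim}(q^{\circledast}\circ i_{\circledast},\,i)(1).$$ Here the first is the weighted limit in the underlying $V$-category of $Q$, with $q$ seen as a functor from the one-point $V$-category and weight $i^{*}\cdot q_{*}$, $x\mapsto Q(q,i(x))$; the second is the $(L,V)$-colimit of $i$ weighted by the $(L,V)$-distributor $q^{\circledast}\circ i_{\circledast}$ from $X$ to the one-point $(L,V)$-category $E=(\{1\},e^{\circ})$ (where $e^{\circ}(\underline{z},1)$ is $k$ if $\underline{z}=(1)$ and $\bot$ otherwise), $\underline{x}\mapsto Q(Li(\underline{x}),q)$. An $(L,V)$-functor $g\colon Z\to Y$ is the $(L,V)$-colimit of $f\colon X\to(Y,b)$ weighted by $j$ from $X$ to $Z$ if $b(Lg(\underline{z}),y)=\bigwedge_{\underline{x}\in LX}[\hat{\jmath}(\underline{x},\underline{z}),b(Lf(\underline{x}),y)]$ for all $\underline z\in LZ$, $y\in Y$, where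 $\hat{\jmath}(\underline{x},\underline{z})$ is the supremum of $Lj((\underline{x}_1,\dots,\underline{x}_n),\underline{z})$ over all $(\underline{x}_1,\dots,\underline{x}_n)\in L^2X$ with concatenation $\underline{x}$. **Proposition.** Every dense $(L,V)$-functor $i\colon (X,a)\to Q$ into a $V$-quantale $Q$ is essential in the category of $(L,V)$-categories: $i$ is fully faithful, and for every $(L,V)$-category $(Z,b)$ and every $(L,V)$-functor $g\colon Q\to Z$ such that $g\circ i$ is fully faithful, $g$ is itself fully faithful. -/

import Mathlib

universe u v

namespace QMulti

/-! ## `V`-relations -/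

section Relations

variable {V : Type v} [CommMonoid V] [CompleteLattice V]

/-- The internal hom `[p, q]` of a commutative quantale: `r ≤ [p, q]` iff `p ⊗ r ≤ q`. -/
abbrev ihom [IsQuantale V] (p q : V) : V := Quantale.rightMulResiduation p q

/-- Composition of `V`-relations: `(s · r) (x, z) = ⋁ y, r (x, y) ⊗ s (y, z)`. -/
def relComp {X Y Z : Type*} (s : Y → Z → V) (r : X → Y → V) : X → Z → V :=
  fun x z => ⨆ y, r x y * s y z

open Classical in
/-- A function regarded as a `V`-relation. -/
noncomputable def graph (V : Type v) [CommMonoid V] [CompleteLattice V] {X Y : Type*}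
    (f : X → Y) : X → Y → V :=
  fun x y => if f x = y then 1 else ⊥

/-- The involution `r ↦ r°`. -/
def conv {X Y : Type*} (r : X → Y → V) : Y → X → V := fun y x => r x y

/-- The extension of the list monad to `V`-relations. -/
def listExt {X Y : Type*} (r : X → Y → V) : List X → List Y → V
  | [], [] => 1
  | x :: xs, y :: ys => r x y * listExt r xs ys
  | [], _ :: _ => ⊥
  | _ :: _, [] => ⊥

/-- `r̂ = L r · m°`, for an `(L,V)`-relation `r : LX ⇸ Y`. -/
noncomputable def lvHat {X Y : Type*} (r : List X → Y → V) : List X → List Y → V :=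
  relComp (listExt r) (conv (graph V (List.flatten : List (List X) → List X)))

/-- Kleisli composition of `(L,V)`-relations: `s ∘ r = s · L r · m°`. -/
noncomputable def lvComp {X Y Z : Type*} (s : List Y → Z → V) (r : List X → Y → V) :
    List X → Z → V :=
  relComp s (lvHat r)

/-- `e°`, the identity for the Kleisli composition, where `e x` is the list `(x)`. -/
noncomputable def lvId (V : Type v) [CommMonoid V] [CompleteLattice V] (X : Type*) :
    List X → X → V :=
  conv (graph V fun x : X => [x])

theorem relComp_le_iff {X Y Z : Type*} {s : Y → Z → V} {r : X → Y → V} {t : X → Z → V} :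
    relComp s r ≤ t ↔ ∀ x y z, r x y * s y z ≤ t x z := by
  constructor
  · intro h x y z
    exact (le_iSup (fun y => r x y * s y z) y).trans (h x z)
  · intro h x z
    exact iSup_le fun y => h x y z

variable [IsQuantale V]

theorem lvHat_le_iff {X Y : Type*} {r : List X → Y → V} {t : List X → List Y → V} :
    lvHat r ≤ t ↔ ∀ xss ys, listExt r xss ys ≤ t xss.flatten ys := by
  rw [lvHat, relComp_le_iff]
  constructor
  · intro h xss ys
    simpa [conv, graph] using h xss.flatten xss ys
  · intro h xs xss ys
    by_cases e : xss.flatten = xs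
    · subst e
      simpa [conv, graph] using h xss ys
    · simp [conv, graph, e]

theorem lvComp_le_iff {X Y Z : Type*} {s : List Y → Z → V} {r : List X → Y → V}
    {t : List X → Z → V} :
    lvComp s r ≤ t ↔ ∀ xss ys z, listExt r xss ys * s ys z ≤ t xss.flatten z := by
  rw [lvComp, relComp_le_iff]
  constructor
  · intro h xss ys z
    exact (mul_le_mul_left (lvHat_le_iff.1 le_rfl xss ys) _).trans (h xss.flatten ys z)
  · intro h xs ys z
    have key : lvHat r ≤ fun xs ys => ihom (s ys z) (t xs z) := by
      refine lvHat_le_iff.2 fun xss ys => ?_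
      rw [Quantale.rightMulResiduation_le_iff_mul_le, mul_comm]
      exact h xss ys z
    have := key xs ys
    rwa [Quantale.rightMulResiduation_le_iff_mul_le, mul_comm] at this

end Relations

/-! ## `V`-categories -/

/-- A `V`-category structure on the set `X`: a `V`-relation `a` with `Id ≤ a` and `a · a ≤ a`. -/
structure VCat (V : Type v) [CommMonoid V] [CompleteLattice V] [IsQuantale V] (X : Type u) where
  hom : X → X → V
  id_le : graph V (id : X → X) ≤ hom
  comp_le : relComp hom hom ≤ hom

section VCategories

variable {V : Type v} [CommMonoid V] [CompleteLattice V] [IsQuantale V]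
variable {X Y Z : Type u}

/-- `V`-functors. -/
def IsVFunctor (a : VCat V X) (b : VCat V Y) (f : X → Y) : Prop :=
  ∀ x y, a.hom x y ≤ b.hom (f x) (f y)

/-- `V`-distributors `j : X ⇸ Z`. -/
structure IsVDistributor (a : VCat V X) (c : VCat V Z) (j : X → Z → V) : Prop where
  comp_left : relComp j a.hom ≤ j
  comp_right : relComp c.hom j ≤ j

/-- `f_* (x, y) = b (f x, y)`. -/
def vLower (b : VCat V Y) (f : X → Y) : X → Y → V := fun x y => b.hom (f x) y

/-- `f^* (y, x) = b (y, f x)`. -/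
def vUpper (b : VCat V Y) (f : X → Y) : Y → X → V := fun y x => b.hom y (f x)

/-- `g : Z → Y` is the colimit of `f : X → Y` weighted by `j : X ⇸ Z`. -/
structure IsVColimit (b : VCat V Y) (c : VCat V Z) (j : X → Z → V) (f : X → Y) (g : Z → Y) :
    Prop where
  isVFunctor : IsVFunctor c b g
  hom_eq : ∀ z y, vLower b g z y = ⨅ x, ihom (j x z) (vLower b f x y)

/-- `h : Z → Y` is the limit of `f : X → Y` weighted by `l : Z ⇸ X`. -/
structure IsVLimit (b : VCat V Y) (c : VCat V Z) (l : Z → X → V) (f : X → Y) (h : Z → Y) :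
    Prop where
  isVFunctor : IsVFunctor c b h
  hom_eq : ∀ y z, vUpper b h y z = ⨅ x, ihom (l z x) (vUpper b f y x)

/-- A `V`-category is cocomplete if it has all weighted colimits. -/
def IsVCocomplete (b : VCat V Y) : Prop :=
  ∀ (X Z : Type u) (a : VCat V X) (c : VCat V Z) (f : X → Y) (j : X → Z → V),
    IsVFunctor a b f → IsVDistributor a c j → ∃ g : Z → Y, IsVColimit b c j f g

/-- A cocontinuous `V`-functor is one that preserves all weighted colimits that exist. -/
structure IsVCocontinuous (b : VCat V Y) (b' : VCat V Z) (h : Y → Z) : Prop where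
  isVFunctor : IsVFunctor b b' h
  preserves : ∀ (X D : Type u) (a : VCat V X) (d : VCat V D) (f : X → Y) (j : X → D → V)
    (g : D → Y), IsVFunctor a b f → IsVDistributor a d j → IsVColimit b d j f g →
      IsVColimit b' d j (h ∘ f) (h ∘ g)

/-- Separated `V`-categories: isomorphic elements are equal. -/
def IsVSeparated (b : VCat V Y) : Prop :=
  ∀ x y, 1 ≤ b.hom x y → 1 ≤ b.hom y x → x = y

/-- The one-point `V`-category `K = (1, k)`. -/
def VCat.point (V : Type v) [CommMonoid V] [CompleteLattice V] [IsQuantale V] :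
    VCat V PUnit.{u + 1} where
  hom _ _ := 1
  id_le _ _ := by simp [graph]
  comp_le := relComp_le_iff.2 fun _ _ _ => (one_mul 1).le

end VCategories

/-- A monoidal `V`-category: a monoid whose multiplication is a `V`-functor `X ⊠ X → X`. -/
structure MonoidalVCat (V : Type v) [CommMonoid V] [CompleteLattice V] [IsQuantale V]
    (X : Type u) [Monoid X] extends VCat V X where
  hom_mul_le : ∀ x x' y y', hom x x' * hom y y' ≤ hom (x * y) (x' * y')

/-- A `V`-quantale: a separated cocomplete monoidal `V`-category whose multiplication is
cocontinuous in each variable, that is, a monoid in the monoidal category of separated cocomplete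
`V`-categories and cocontinuous `V`-functors. -/
structure VQuantale (V : Type v) [CommMonoid V] [CompleteLattice V] [IsQuantale V]
    (Q : Type u) [Monoid Q] extends MonoidalVCat V Q where
  separated : IsVSeparated toVCat
  cocomplete : IsVCocomplete toVCat
  cocontinuous_mul_right : ∀ x, IsVCocontinuous toVCat toVCat fun y => y * x
  cocontinuous_mul_left : ∀ x, IsVCocontinuous toVCat toVCat fun y => x * y

/-! ## `(L,V)`-categories -/

/-- An `(L,V)`-category structure on the set `X`: an `(L,V)`-relation `a : LX ⇸ X` with `e° ≤ a`
and `a ∘ a ≤ a`. -/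
structure LVCat (V : Type v) [CommMonoid V] [CompleteLattice V] [IsQuantale V] (X : Type u) where
  hom : List X → X → V
  id_le : lvId V X ≤ hom
  comp_le : lvComp hom hom ≤ hom

section LVCategories

variable {V : Type v} [CommMonoid V] [CompleteLattice V] [IsQuantale V]
variable {X Y Z : Type u}

/-- `(L,V)`-functors. -/
def IsLVFunctor (a : LVCat V X) (b : LVCat V Y) (f : X → Y) : Prop :=
  ∀ xs y, a.hom xs y ≤ b.hom (xs.map f) (f y)

/-- Fully faithful `(L,V)`-functors. -/
def IsFullyFaithful (a : LVCat V X) (b : LVCat V Y) (f : X → Y) : Prop :=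
  ∀ xs y, a.hom xs y = b.hom (xs.map f) (f y)

/-- `f_⊛ (xs, y) = b (L f xs, y)`. -/
def lvLower (b : LVCat V Y) (f : X → Y) : List X → Y → V := fun xs y => b.hom (xs.map f) y

/-- `f^⊛ (ys, x) = b (ys, f x)`. -/
def lvUpper (b : LVCat V Y) (f : X → Y) : List Y → X → V := fun ys x => b.hom ys (f x)

/-- `g : Z → Y` is the `(L,V)`-colimit of `f : X → Y` weighted by the `(L,V)`-distributor `j`
from `X` to `Z`, that is, `g_⊛` is the right extension of `f_⊛` along `j`. -/
structure IsLVColimit (b : LVCat V Y) (c : LVCat V Z) (j : List X → Z → V) (f : X → Y)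
    (g : Z → Y) : Prop where
  isLVFunctor : IsLVFunctor c b g
  hom_eq : ∀ zs y, lvLower b g zs y = ⨅ xs, ihom (lvHat j xs zs) (lvLower b f xs y)

theorem listExt_lvId (xss : List (List X)) (ys : List X) :
    listExt (lvId V X) xss ys = ⊥ ∨ xss.flatten = ys ∧ listExt (lvId V X) xss ys = 1 := by
  induction xss generalizing ys with
  | nil => cases ys <;> simp [listExt]
  | cons xs xss ih =>
    cases ys with
    | nil => simp [listExt]
    | cons y ys =>
      by_cases e : [y] = xs
      · subst e
        rcases ih ys with h | ⟨h, h'⟩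
        · exact Or.inl (by simp [listExt, h])
        · refine Or.inr ⟨by simp [h], ?_⟩
          rw [listExt, h', mul_one]
          simp [lvId, conv, graph]
      · exact Or.inl (by simp [listExt, lvId, conv, graph, e])

/-- The one-point `(L,V)`-category `E = (1, e°)`. -/
noncomputable def LVCat.point (V : Type v) [CommMonoid V] [CompleteLattice V] [IsQuantale V] :
    LVCat V PUnit.{u + 1} where
  hom := lvId V PUnit
  id_le := le_rfl
  comp_le := lvComp_le_iff.2 fun xss ys z => by
    rcases listExt_lvId (V := V) xss ys with h | ⟨h, h'⟩
    · simp [h]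
    · rw [h', h, one_mul]

/-- The underlying `V`-category of an `(L,V)`-category, with `a₀ (x, y) = a ((x), y)`. -/
def LVCat.toVCat (a : LVCat V X) : VCat V X where
  hom x y := a.hom [x] y
  id_le x y := by
    by_cases e : x = y
    · subst e
      simpa [lvId, conv, graph] using a.id_le [x] x
    · simp [graph, e]
  comp_le := relComp_le_iff.2 fun x y z => by
    simpa [listExt] using lvComp_le_iff.1 a.comp_le [[x]] [y] z

theorem MonoidalVCat.listExt_le {Q : Type u} [Monoid Q] (b : MonoidalVCat V Q)
    (xss : List (List Q)) (ys : List Q) :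
    listExt (fun xs y => b.hom xs.prod y) xss ys ≤ b.hom xss.flatten.prod ys.prod := by
  induction xss generalizing ys with
  | nil =>
    cases ys with
    | nil => simpa [listExt, graph] using b.id_le 1 1
    | cons y ys => simp [listExt]
  | cons xs xss ih =>
    cases ys with
    | nil => simp [listExt]
    | cons y ys =>
      simp only [listExt, List.flatten_cons, List.prod_append, List.prod_cons]
      exact (mul_le_mul_right (ih ys) _).trans (b.hom_mul_le _ _ _ _)

/-- The `(L,V)`-category of a monoidal `V`-category: `â ((x₁, …, xₙ), y) = a (x₁ * ⋯ * xₙ, y)`,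
the empty product being the unit. -/
def MonoidalVCat.toLVCat {Q : Type u} [Monoid Q] (b : MonoidalVCat V Q) : LVCat V Q where
  hom xs y := b.hom xs.prod y
  id_le xs y := by
    by_cases e : [y] = xs
    · subst e
      simpa [lvId, conv, graph] using b.id_le y y
    · simp [lvId, conv, graph, e]
  comp_le := lvComp_le_iff.2 fun xss ys z =>
    (mul_le_mul_left (b.listExt_le xss ys) _).trans (relComp_le_iff.1 b.comp_le _ _ _)

/-- An `(L,V)`-functor `i` from `X` to a `V`-quantale `Q` is dense if it is fully faithful and
every `q` in `Q` is both the limit (in the underlying `V`-category) of `i` weighted by `i^* · q_*`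
and the `(L,V)`-colimit of `i` weighted by the composite of `i_⊛` from `X` to `Q` and `q^⊛` from
`Q` to `E`. Here `q` is regarded as a functor from the one-point category. -/
structure IsDense {Q : Type u} [Monoid Q] (a : LVCat V X) (b : VQuantale V Q) (i : X → Q) :
    Prop where
  isFullyFaithful : IsFullyFaithful a b.toLVCat i
  isVLimit : ∀ q : Q,
    IsVLimit b.toLVCat.toVCat (VCat.point V)
      (relComp (vUpper b.toLVCat.toVCat i)
        (vLower b.toLVCat.toVCat fun _ : PUnit.{u + 1} => q))
      i (fun _ => q)
  isLVColimit : ∀ q : Q,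
    IsLVColimit b.toLVCat (LVCat.point V)
      (lvComp (lvUpper b.toLVCat fun _ : PUnit.{u + 1} => q) (lvLower b.toLVCat i))
      i (fun _ => q)

/-- A morphism `i` of `(L,V)`-categories is essential (for the class of fully faithful
`(L,V)`-functors) if it is fully faithful and every `(L,V)`-functor `g` whose composite with `i`
is fully faithful is itself fully faithful. -/
structure IsEssential (a : LVCat V X) (b : LVCat V Y) (i : X → Y) : Prop where
  isFullyFaithful : IsFullyFaithful a b i
  of_comp : ∀ (Z : Type u) (c : LVCat V Z) (g : Y → Z), IsLVFunctor b c g →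
    IsFullyFaithful a c (g ∘ i) → IsFullyFaithful b c g

end LVCategories

end QMulti

/-!
Write `Q (p, q)` for the hom of the `V`-quantale. Fully faithfulness of `g` means that
`c (L g qs, g q) ≤ Q (q₁ * ⋯ * qₙ, q)`, the other inequality being functoriality. Density reduces
both variables to elements coming from `X`:

* the limit condition gives `Q (p, q) = ⨅ x, [Q (q, i x), Q (p, i x)]`, so that `q` may be replaced
  by `i x` at the cost of a factor `Q (q, i x)`;
* the `(L,V)`-colimit condition, at the list of length one, says that `q` is a `V`-colimit of the
  elements `i x₁ * ⋯ * i xₘ`, indexed by the discrete `V`-category `LX`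
  (`IsDense.isVColimit_prod`). Multiplication preserves this colimit in each variable, so each
  `qₖ` may be replaced by a product of elements `i x`, at the cost of a factor
  `Q (L i xsₖ, qₖ)` (`IsDense.le_hom_mul_prod`).

There remains the inequality
`⨂ₖ Q (L i xsₖ, qₖ) ⊗ c (L g qs, g q) ⊗ Q (q, i x) ≤ Q (L i (xs₁; …; xsₙ), i x)`. The functor `g`
sends the factors on the left to homs in `Z`, where they compose to
`c (L (g ∘ i) (xs₁; …; xsₙ), g (i x))`. This equals the right-hand side, since `g ∘ i` and `i` are
both fully faithful.
-/

namespace QMulti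

section Relations

variable {V : Type v} [CommMonoid V] [CompleteLattice V] [IsQuantale V]

theorem listExt_le_listExt_map {X Y X' Y' : Type*} {r : X → Y → V} {s : X' → Y' → V}
    {f : X → X'} {h : Y → Y'} (H : ∀ x y, r x y ≤ s (f x) (h y)) (xs : List X) (ys : List Y) :
    listExt r xs ys ≤ listExt s (xs.map f) (ys.map h) := by
  induction xs generalizing ys with
  | nil => cases ys <;> simp [listExt]
  | cons x xs ih =>
    cases ys with
    | nil => simp [listExt]
    | cons y ys => exact mul_le_mul' (H x y) (ih ys)

theorem lvHat_singleton_le {X Y : Type*} (r : List X → Y → V) (xs : List X) (y : Y) :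
    lvHat r xs [y] ≤ r xs y := by
  -- The bound is a relation to `LY` that is nontrivial only at the lists of length one.
  have key : lvHat r ≤ fun xs ys => ⨅ (y : Y) (_ : ys = [y]), r xs y := by
    refine lvHat_le_iff.2 fun xss ys => le_iInf₂ fun y hy => ?_
    subst hy
    match xss with
    | [] => simp [listExt]
    | [xs] => simp [listExt]
    | _ :: _ :: _ => simp [listExt]
  exact (key xs [y]).trans (iInf_le_of_le y (iInf_le _ rfl))

/-- The discrete `V`-category on a set. -/
noncomputable def VCat.discrete (V : Type v) [CommMonoid V] [CompleteLattice V] [IsQuantale V]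
    (X : Type u) : VCat V X where
  hom := graph V id
  id_le := le_rfl
  comp_le := relComp_le_iff.2 fun x y z => by
    by_cases e : x = y
    · subst e
      simp [graph]
    · simp [graph, e]

end Relations

section Categories

variable {V : Type v} [CommMonoid V] [CompleteLattice V] [IsQuantale V]

theorem VCat.one_le_hom {X : Type u} (a : VCat V X) (x : X) : 1 ≤ a.hom x x := by
  simpa [graph] using a.id_le x x

theorem VCat.hom_mul_hom_le {X : Type u} (a : VCat V X) (x y z : X) :
    a.hom x y * a.hom y z ≤ a.hom x z :=
  relComp_le_iff.1 a.comp_le x y z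

theorem LVCat.listExt_mul_hom_le {X : Type u} (a : LVCat V X) (xss : List (List X)) (ys : List X)
    (z : X) : listExt a.hom xss ys * a.hom ys z ≤ a.hom xss.flatten z :=
  lvComp_le_iff.1 a.comp_le xss ys z

theorem LVCat.hom_mul_hom_singleton_le {X : Type u} (a : LVCat V X) (xs : List X) (y z : X) :
    a.hom xs y * a.hom [y] z ≤ a.hom xs z := by
  simpa [listExt] using a.listExt_mul_hom_le [xs] [y] z

theorem isVFunctor_discrete {X Y : Type u} (b : VCat V Y) (f : X → Y) :
    IsVFunctor (VCat.discrete V X) b f := by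
  intro x y
  by_cases e : x = y
  · subst e
    simpa [VCat.discrete, graph] using b.one_le_hom (f x)
  · simp [VCat.discrete, graph, e]

theorem isVDistributor_discrete_point {X : Type u} (j : X → PUnit.{u + 1} → V) :
    IsVDistributor (VCat.discrete V X) (VCat.point V) j where
  comp_left := relComp_le_iff.2 fun x y z => by
    by_cases e : x = y
    · subst e
      simp [VCat.discrete, graph]
    · simp [VCat.discrete, graph, e]
  comp_right := relComp_le_iff.2 fun _ _ _ => (mul_one _).le

variable {X Q : Type u} [Monoid Q] {a : LVCat V X} {b : VQuantale V Q} {i : X → Q}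

/-- `i` generates every `q` as a `V`-colimit of products: the weight `q^⊛ ∘ i_⊛` of the
`(L,V)`-colimit, extended to lists of length one, lies below `xs ↦ Q (L i xs, q)`. -/
theorem IsDense.isVColimit_prod (hi : IsDense a b i) (q : Q) :
    IsVColimit b.toVCat (VCat.point V) (fun xs _ => b.hom (xs.map i).prod q)
      (fun xs : List X => (xs.map i).prod) (fun _ : PUnit.{u + 1} => q) where
  isVFunctor _ _ := b.one_le_hom q
  hom_eq := by
    intro z y
    refine le_antisymm (le_iInf fun xs => ?_) ?_
    · rw [Quantale.rightMulResiduation_le_iff_mul_le]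
      exact b.hom_mul_hom_le _ _ _
    · have h := (hi.isLVColimit q).hom_eq [z] y
      simp only [lvLower, MonoidalVCat.toLVCat, List.map_cons, List.map_nil,
        List.prod_singleton] at h
      rw [vLower, h]
      refine iInf_mono fun xs => ?_
      rw [Quantale.rightMulResiduation_le_iff_mul_le]
      refine le_trans (mul_le_mul_left ?_ _)
        (Quantale.rightMulResiduation_le_iff_mul_le.1 le_rfl)
      refine (lvHat_singleton_le _ _ _).trans ?_
      have key : lvComp (lvUpper b.toLVCat fun _ : PUnit.{u + 1} => q) (lvLower b.toLVCat i) ≤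
          fun xs _ => b.toLVCat.hom (xs.map i) q := by
        refine lvComp_le_iff.2 fun xss ys _ => ?_
        have h₁ : listExt (lvLower b.toLVCat i) xss ys ≤
            listExt b.toLVCat.hom (xss.map (List.map i)) ys := by
          simpa using listExt_le_listExt_map (r := lvLower b.toLVCat i) (s := b.toLVCat.hom)
            (f := List.map i) (h := id) (fun _ _ => le_rfl) xss ys
        rw [List.map_flatten]
        exact (mul_le_mul_left h₁ _).trans (b.toLVCat.listExt_mul_hom_le _ ys q)
      exact key xs z

/-- To bound `Q (p * q * r, y)` from below, `q` may be replaced by products of elements `i x`. -/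
theorem IsDense.le_hom_mul_mul (hi : IsDense a b i) {p q r y : Q} {v : V}
    (H : ∀ xs : List X, v * b.hom (xs.map i).prod q ≤ b.hom (p * (xs.map i).prod * r) y) :
    v ≤ b.hom (p * q * r) y := by
  have h₁ := (b.cocontinuous_mul_left p).preserves _ _ _ _ _ _ _ (isVFunctor_discrete _ _)
    (isVDistributor_discrete_point _) (hi.isVColimit_prod q)
  have h₂ := (b.cocontinuous_mul_right r).preserves _ _ _ _ _ _ _ (isVFunctor_discrete _ _)
    (isVDistributor_discrete_point _) h₁
  have h₃ := h₂.hom_eq PUnit.unit y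
  simp only [vLower, Function.comp_apply] at h₃
  rw [h₃]
  refine le_iInf fun xs => ?_
  rw [Quantale.rightMulResiduation_le_iff_mul_le, mul_comm]
  exact H xs

/-- To bound `Q (q₁ * ⋯ * qₙ, y)` from below, all `qₖ` may be replaced by products of elements
`i x`. The left factor `p` makes the induction on the list work. -/
theorem IsDense.le_hom_mul_prod (hi : IsDense a b i) {y : Q} (qs : List Q) {p : Q} {v : V}
    (H : ∀ xss : List (List X), v * listExt (fun xs q => b.hom (xs.map i).prod q) xss qs ≤
      b.hom (p * (xss.flatten.map i).prod) y) :
    v ≤ b.hom (p * qs.prod) y := by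
  induction qs generalizing p v with
  | nil => simpa [listExt] using H []
  | cons q qs ih =>
    rw [List.prod_cons, ← mul_assoc]
    refine ih fun xss => hi.le_hom_mul_mul fun xs => ?_
    have h := H (xs :: xss)
    simp only [listExt, List.flatten_cons, List.map_append, List.prod_append] at h
    rwa [mul_assoc v, mul_comm (listExt _ _ _), mul_assoc p]

theorem IsDense.le_hom_prod (hi : IsDense a b i) {y : Q} (qs : List Q) {v : V}
    (H : ∀ xss : List (List X), v * listExt (fun xs q => b.hom (xs.map i).prod q) xss qs ≤
      b.hom (xss.flatten.map i).prod y) :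
    v ≤ b.hom qs.prod y := by
  simpa using hi.le_hom_mul_prod (p := 1) qs (by simpa using H)

/-- To bound `Q (p, q)` from below, `q` may be replaced by the elements `i x`. -/
theorem IsDense.le_hom (hi : IsDense a b i) {p q : Q} {v : V}
    (H : ∀ x : X, v * b.hom q (i x) ≤ b.hom p (i x)) : v ≤ b.hom p q := by
  have h := (hi.isVLimit q).hom_eq p PUnit.unit
  simp only [vUpper, LVCat.toVCat, MonoidalVCat.toLVCat, List.prod_singleton] at h
  rw [h]
  refine le_iInf fun x => ?_
  rw [Quantale.rightMulResiduation_le_iff_mul_le, mul_comm]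
  refine le_trans (mul_le_mul_right ?_ v) (H x)
  -- The weight `i^* · q_*` at `x` lies below `Q (q, i x)`, by composition in `Q`.
  refine iSup_le fun y => ?_
  simpa [vLower, vUpper] using b.hom_mul_hom_le q y (i x)

end Categories

end QMulti

open QMulti in
theorem mainTheorem5 {V : Type v} [CommMonoid V] [CompleteLattice V] [IsQuantale V]
    {X Q : Type u} [Monoid Q] (a : QMulti.LVCat V X) (b : QMulti.VQuantale V Q) (i : X → Q)
    (hi : QMulti.IsDense a b i) :
    QMulti.IsEssential a b.toLVCat i := by
  refine ⟨hi.isFullyFaithful, fun Z c g hg hgi qs q => le_antisymm (hg qs q) ?_⟩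
  refine hi.le_hom fun x => hi.le_hom_prod qs fun xss => ?_
  have h₁ : b.hom q (i x) ≤ c.hom [g q] (g (i x)) := by
    simpa [MonoidalVCat.toLVCat] using hg [q] (i x)
  have h₂ : listExt (fun xs q => b.hom (xs.map i).prod q) xss qs ≤
      listExt c.hom (xss.map (List.map (g ∘ i))) (qs.map g) :=
    listExt_le_listExt_map (fun xs q => by
      simpa [MonoidalVCat.toLVCat] using hg (xs.map i) q) xss qs
  have h₃ : b.hom (xss.flatten.map i).prod (i x) =
      c.hom (xss.map (List.map (g ∘ i))).flatten (g (i x)) := by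
    rw [← List.map_flatten]
    exact (hi.isFullyFaithful xss.flatten x).symm.trans (hgi xss.flatten x)
  rw [h₃, mul_comm]
  exact (mul_le_mul' h₂ ((mul_le_mul_right h₁ _).trans (c.hom_mul_hom_singleton_le _ _ _))).trans
    (c.listExt_mul_hom_le _ _ _)
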